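/- Let $q$ be a complex number with $|q|<1$. Write $(a;q)_n=\prod_{k=0}^{n-1}(1-aq^k)$, $(a;q)_\infty=\prod_{k\ge 0}(1-aq^k)$, $(a_1,\dots,a_j;q)_\infty=\prod_{i=1}^j(a_i;q)_\infty$, $(q)_n=(q;q)_n$, $(q)_\infty=(q;q)_\infty$. For integers $m\ge 0$ and $0\le r\le 2m$ put $$\sigma(m,r)=\frac{(-1)^r q^{\frac32r^2+\frac12r}(q^2;q^3)_r}{(q^2;q^3)_{2m}(q^3;q^3)_{2m-r}(q)_{3r}} .$$ Let $\beta_n=\beta^{(3,1)}_n(1,q)=\sum_{s=0}^n\frac{\alpha_s}{(q)_{n-s}(q)_{n+s}}$ for $n\ge 0$ and $\beta_{-1}=0$, where $\alpha_0=1$, $\alpha_s=2$ if $3\mid s$ and $s>0$, and $\alpha_s=-1$ if $3\nmid s$ (this is the Bailey pair attached to the level $3$ standard module $(3,0)$ of $A_2^{(2)}$). Then both series below converge, and $$\begin{aligned} &\sum_{m=0}^\infty q^{9m^2}\Bigl(q^{-6m+1}\beta_{3m-1}+\beta_{3m}+q^{6m+1}\beta_{3m+1}\Bigr)\\ &=\sum_{m=0}^\infty\sum_{r=0}^{2m}q^{9m^2}\sigma(m,r)\left(q^{1-6m}\Bigl(q^{6m}-\frac{1-q^{6m+1}}{1-q^{3r+1}}\Bigr)+1+\frac{q^{6m+1}}{1-q^{6m+2}}\Bigl(\frac{1}{1-q^{3r+1}}-1\Bigr)\right)\\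 &=\frac{(q,q^5,q^6;q^6)_\infty(q^4,q^8;q^{12})_\infty}{(q)_\infty}=\frac{1}{(q^2,q^3,q^9,q^{10};q^{12})_\infty}=(-q^2;q^2)_\infty(-q^3;q^6)_\infty . \end{aligned}$$ (At $q=0$ the product $q^{9m^2}q^{1-6m}$ is read as $q^{9m^2-6m+1}$.) -/

import Mathlib

namespace Capparelli

/-- The finite `q`-Pochhammer symbol `(a; q)_n = ∏_{k=0}^{n-1} (1 - a q^k)`. -/
noncomputable def qPoch (a q : ℂ) (n : ℕ) : ℂ :=
  ∏ k ∈ Finset.range n, (1 - a * q ^ k)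

/-- The infinite `q`-Pochhammer symbol `(a; q)_∞ = ∏_{k ≥ 0} (1 - a q^k)`. -/
noncomputable def qPochInf (a q : ℂ) : ℂ :=
  ∏' k : ℕ, (1 - a * q ^ k)

theorem summable_norm_neg_mul_pow (a q : ℂ) (hq : ‖q‖ < 1) :
    Summable (fun k : ℕ => ‖-(a * q ^ k)‖) := by
  simp only [norm_neg, norm_mul, norm_pow]
  exact (summable_geometric_of_lt_one (norm_nonneg q) hq).mul_left _

/-- The product defining `(a; q)_∞` converges for `|q| < 1`. -/
theorem multipliable_qPochInf (a q : ℂ) (hq : ‖q‖ < 1) :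
    Multipliable (fun k : ℕ => 1 - a * q ^ k) := by
  simpa only [sub_eq_add_neg] using
    multipliable_one_add_of_summable (summable_norm_neg_mul_pow a q hq)

/-- For `|q| < 1`, `(a; q)_∞` vanishes only if one of its factors does. -/
theorem qPochInf_ne_zero (a q : ℂ) (hq : ‖q‖ < 1) (h : ∀ k : ℕ, 1 - a * q ^ k ≠ 0) :
    qPochInf a q ≠ 0 := by
  have := tprod_one_add_ne_zero_of_summable (f := fun k : ℕ => -(a * q ^ k))
    (fun k => by simpa only [sub_eq_add_neg] using h k) (summable_norm_neg_mul_pow a q hq)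
  simpa only [qPochInf, sub_eq_add_neg] using this

/-- The exponent `(3/2)(ℓ-3)r² + (1/2)(ℓ-3)r`; the integer division is exact, as `3r² + r` is
even. -/
def alphaExp (ℓ : ℕ) (r : ℤ) : ℤ :=
  ((ℓ : ℤ) - 3) * ((3 * r ^ 2 + r) / 2)

/-- The sequence `α_n^{(ℓ,1)}(1, q)` attached to the `(ℓ, 0)`-module of `A_2^{(2)}`: it is `1` at
`n = 0`, and otherwise
`q^{(3/2)(ℓ-3)r² - (1/2)(ℓ-3)r} + q^{(3/2)(ℓ-3)r² + (1/2)(ℓ-3)r}` at `n = 3r`,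
`-q^{(3/2)(ℓ-3)r² + (1/2)(ℓ-3)r}` at `n = 3r + 1`,
`-q^{(3/2)(ℓ-3)r² - (1/2)(ℓ-3)r}` at `n = 3r - 1`. -/
noncomputable def alpha (ℓ : ℕ) (q : ℂ) (n : ℕ) : ℂ :=
  if n = 0 then 1
  else if n % 3 = 0 then
    q ^ alphaExp ℓ (-((n : ℤ) / 3)) + q ^ alphaExp ℓ ((n : ℤ) / 3)
  else if n % 3 = 1 then -q ^ alphaExp ℓ (((n : ℤ) - 1) / 3)
  else -q ^ alphaExp ℓ (-(((n : ℤ) + 1) / 3))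

/-- The partner of `alpha` in the Bailey pair relative to `a = 1`:
`β_n^{(ℓ,1)}(1, q) = ∑_{s=0}^n α_s / ((q; q)_{n-s} (q; q)_{n+s})`.
The index is an integer; for `n < 0` the sum is empty, so `β_n = 0`. -/
noncomputable def beta (ℓ : ℕ) (q : ℂ) (n : ℤ) : ℂ :=
  ∑ s ∈ Finset.range (n + 1).toNat,
    alpha ℓ q s / (qPoch q q (n - s).toNat * qPoch q q (n + s).toNat)

/-- `σ(m, r) = (-1)^r q^{(3/2) r² + (1/2) r} (q²; q³)_r /
((q²; q³)_{2m} (q³; q³)_{2m-r} (q; q)_{3r})`, used for `0 ≤ r ≤ 2 m`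
(the division by `2` in the exponent is exact). -/
noncomputable def sigma (q : ℂ) (m r : ℕ) : ℂ :=
  (-1) ^ r * q ^ ((3 * r ^ 2 + r) / 2) * qPoch (q ^ 2) (q ^ 3) r /
    (qPoch (q ^ 2) (q ^ 3) (2 * m) * qPoch (q ^ 3) (q ^ 3) (2 * m - r) * qPoch q q (3 * r))

end Capparelli

namespace Capparelli

open Finset Filter Topology

/-! Take a primitive cube root of unity `w`. For `s > 0` the level 3 sequence is `α_s = w^s +
w^(-s)`, so the Bailey sum for `β_n` unfolds to a sum over `-n ≤ s ≤ n`, and `(q)_{2n} β_n` is the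
Rogers–Szegő polynomial of degree `2n` at `w`, times `w^(2n)`.

Product side: Bailey's lemma (`hasSum_bailey`) gives `∑ q^(n²) β_n = (∑ α_s q^(s²)) / (q)_∞`. The
theta series is the Jacobi triple product at `w`, which `(1 - y + y²)(1 + y) = 1 + y³` simplifies
(`tsum_alpha_three_mul_pow_sq`). Grouping `n = 3m-1, 3m, 3m+1` yields the first series.

Double sum: the normalized Rogers–Szegő polynomials obey a three-term recurrence free of `w`. At
indices `3M` and `3M+1` it is solved by explicit sums with base `q³` (`cubicSzego_three_mul`).
Taking `M = 2m`, dividing by `(q)_{6m}` and stepping the recurrence up or down expresses `β_{3m}`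
and `β_{3m±1}` through `σ(m, r)`. -/

theorem qPoch_zero (a q : ℂ) : qPoch a q 0 = 1 := by simp [qPoch]

theorem qPoch_succ (a q : ℂ) (n : ℕ) : qPoch a q (n + 1) = qPoch a q n * (1 - a * q ^ n) := by
  simp [qPoch, prod_range_succ]

theorem qPoch_succ' (a q : ℂ) (n : ℕ) : qPoch a q (n + 1) = (1 - a) * qPoch (a * q) q n := by
  simp only [qPoch, prod_range_succ', pow_zero, mul_one, pow_succ]
  rw [mul_comm]
  congr 1
  exact prod_congr rfl fun k _ => by ring

theorem qPoch_self_succ (q : ℂ) (n : ℕ) :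
    qPoch q q (n + 1) = qPoch q q n * (1 - q ^ (n + 1)) := by
  rw [qPoch_succ, pow_succ']

theorem qPoch_add (a q : ℂ) (m n : ℕ) :
    qPoch a q (m + n) = qPoch a q m * qPoch (a * q ^ m) q n := by
  simp only [qPoch, prod_range_add]
  congr 1
  exact prod_congr rfl fun k _ => by ring

theorem one_sub_ne_zero {z : ℂ} (hz : ‖z‖ < 1) : 1 - z ≠ 0 := by
  intro h
  rw [← sub_eq_zero.mp h, norm_one] at hz
  exact lt_irrefl _ hz

theorem norm_pow_lt_one {q : ℂ} (hq : ‖q‖ < 1) {n : ℕ} (hn : n ≠ 0) : ‖q ^ n‖ < 1 := by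
  rw [norm_pow]
  exact pow_lt_one₀ (norm_nonneg q) hq hn

theorem one_sub_pow_ne_zero {q : ℂ} (hq : ‖q‖ < 1) {n : ℕ} (hn : n ≠ 0) : 1 - q ^ n ≠ 0 :=
  one_sub_ne_zero (norm_pow_lt_one hq hn)

theorem one_sub_mul_pow_ne_zero {a q : ℂ} (ha : ‖a‖ < 1) (hq : ‖q‖ < 1) (k : ℕ) :
    1 - a * q ^ k ≠ 0 := by
  apply one_sub_ne_zero
  rw [norm_mul, norm_pow]
  exact mul_lt_one_of_nonneg_of_lt_one_left (norm_nonneg a) ha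
    (pow_le_one₀ (norm_nonneg q) hq.le)

theorem qPoch_ne_zero {a q : ℂ} (ha : ‖a‖ < 1) (hq : ‖q‖ < 1) (n : ℕ) : qPoch a q n ≠ 0 :=
  prod_ne_zero_iff.mpr fun k _ => one_sub_mul_pow_ne_zero ha hq k

theorem qPochInf_ne_zero_of_norm_lt {a q : ℂ} (ha : ‖a‖ < 1) (hq : ‖q‖ < 1) :
    qPochInf a q ≠ 0 :=
  qPochInf_ne_zero a q hq (one_sub_mul_pow_ne_zero ha hq)

/-! ### Gaussian binomials and Rogers–Szegő polynomials -/

/-- The Gaussian binomial coefficient. -/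
noncomputable def qBinom (q : ℂ) (n k : ℕ) : ℂ :=
  if k ≤ n then qPoch q q n / (qPoch q q k * qPoch q q (n - k)) else 0

theorem qBinom_of_lt (q : ℂ) {n k : ℕ} (h : n < k) : qBinom q n k = 0 :=
  if_neg (by omega)

theorem qBinom_add (q : ℂ) (k j : ℕ) :
    qBinom q (k + j) k = qPoch q q (k + j) / (qPoch q q k * qPoch q q j) := by
  rw [qBinom, if_pos (by omega), Nat.add_sub_cancel_left]

theorem qBinom_zero_right {q : ℂ} (hq : ‖q‖ < 1) (n : ℕ) : qBinom q n 0 = 1 := by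
  have := qPoch_ne_zero hq hq n
  simp [qBinom, qPoch_zero, this]

theorem qBinom_self {q : ℂ} (hq : ‖q‖ < 1) (n : ℕ) : qBinom q n n = 1 := by
  have := qPoch_ne_zero hq hq n
  simp [qBinom, qPoch_zero, this]

theorem qBinom_succ_succ {q : ℂ} (hq : ‖q‖ < 1) (n k : ℕ) :
    qBinom q (n + 1) (k + 1) = qBinom q n (k + 1) + q ^ (n - k) * qBinom q n k := by
  rcases lt_trichotomy n k with h | rfl | h
  · rw [qBinom_of_lt q (by omega), qBinom_of_lt q (by omega), qBinom_of_lt q h]; simp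
  · rw [qBinom_self hq, qBinom_self hq, qBinom_of_lt q (by omega)]; simp
  · obtain ⟨j, rfl⟩ := Nat.exists_eq_add_of_lt h
    have e1 : k + j + 1 = k + (j + 1) := by ring
    have e2 : k + j + 1 = (k + 1) + j := by ring
    have e3 : k + j + 1 + 1 = (k + 1) + (j + 1) := by ring
    have e4 : k + j + 1 - k = j + 1 := by omega
    have e5 : k + 1 + (j + 1) = (k + j + 1) + 1 := by ring
    rw [e4, e3, qBinom_add, e2, qBinom_add, ← e2, e1, qBinom_add, ← e1, e5,
      qPoch_self_succ q (k + j + 1), qPoch_self_succ q k, qPoch_self_succ q j]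
    have h1 := qPoch_ne_zero hq hq k
    have h2 := qPoch_ne_zero hq hq j
    have h3 := one_sub_pow_ne_zero hq (Nat.succ_ne_zero k)
    have h4 := one_sub_pow_ne_zero hq (Nat.succ_ne_zero j)
    simp only [Nat.succ_eq_add_one] at h3 h4
    field_simp
    ring

theorem qBinom_succ_succ' {q : ℂ} (hq : ‖q‖ < 1) (n k : ℕ) :
    qBinom q (n + 1) (k + 1) = q ^ (k + 1) * qBinom q n (k + 1) + qBinom q n k := by
  rcases lt_trichotomy n k with h | rfl | h
  · rw [qBinom_of_lt q (by omega), qBinom_of_lt q (by omega), qBinom_of_lt q h]; simp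
  · rw [qBinom_self hq, qBinom_self hq, qBinom_of_lt q (by omega)]; simp
  · obtain ⟨j, rfl⟩ := Nat.exists_eq_add_of_lt h
    have e1 : k + j + 1 = k + (j + 1) := by ring
    have e2 : k + j + 1 = (k + 1) + j := by ring
    have e3 : k + j + 1 + 1 = (k + 1) + (j + 1) := by ring
    have e5 : k + 1 + (j + 1) = (k + j + 1) + 1 := by ring
    rw [e3, qBinom_add, e2, qBinom_add, ← e2, e1, qBinom_add, ← e1, e5,
      qPoch_self_succ q (k + j + 1), qPoch_self_succ q k, qPoch_self_succ q j]
    have h1 := qPoch_ne_zero hq hq k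
    have h2 := qPoch_ne_zero hq hq j
    have h3 := one_sub_pow_ne_zero hq (Nat.succ_ne_zero k)
    have h4 := one_sub_pow_ne_zero hq (Nat.succ_ne_zero j)
    simp only [Nat.succ_eq_add_one] at h3 h4
    field_simp
    ring

theorem one_sub_pow_mul_qBinom {q : ℂ} (hq : ‖q‖ < 1) {n k : ℕ} (hk : k ≤ n + 1) :
    (1 - q ^ (n + 1 - k)) * qBinom q (n + 1) k = (1 - q ^ (n + 1)) * qBinom q n k := by
  rcases hk.eq_or_lt with rfl | h
  · rw [qBinom_of_lt q (Nat.lt_succ_self n), Nat.sub_self]; simp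
  · obtain ⟨j, rfl⟩ := Nat.exists_eq_add_of_le (Nat.lt_succ_iff.mp h)
    have e1 : k + j + 1 - k = j + 1 := by omega
    rw [e1, qBinom_add, show k + j + 1 = k + (j + 1) by ring, qBinom_add,
      show k + (j + 1) = k + j + 1 by ring, qPoch_self_succ, qPoch_self_succ]
    have h1 := qPoch_ne_zero hq hq k
    have h2 := qPoch_ne_zero hq hq j
    have h4 := one_sub_pow_ne_zero hq (Nat.succ_ne_zero j)
    simp only [Nat.succ_eq_add_one] at h4
    field_simp

/-- The Rogers–Szegő polynomial. -/
noncomputable def rogersSzego (q x : ℂ) (n : ℕ) : ℂ :=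
  ∑ k ∈ range (n + 1), qBinom q n k * x ^ k

/-- In Pascal's rule write `q^(n+1-k) = 1 - (1 - q^(n+1-k))`; absorption (`one_sub_pow_mul_qBinom`)
turns the second part into the polynomial two degrees lower. -/
theorem rogersSzego_succ_succ {q : ℂ} (hq : ‖q‖ < 1) (x : ℂ) (n : ℕ) :
    rogersSzego q x (n + 2) =
      (1 + x) * rogersSzego q x (n + 1) - x * (1 - q ^ (n + 1)) * rogersSzego q x n := by
  have h1 : ∑ k ∈ range (n + 2), qBinom q (n + 1) (k + 1) * x ^ (k + 1) + 1 =
      rogersSzego q x (n + 1) := by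
    have := sum_range_succ' (fun k => qBinom q (n + 1) k * x ^ k) (n + 2)
    rw [sum_range_succ, qBinom_of_lt q (by omega : n + 1 < n + 2), qBinom_zero_right hq] at this
    rw [rogersSzego]
    linear_combination -this
  have h2 : (1 - q ^ (n + 1)) * rogersSzego q x n =
      ∑ k ∈ range (n + 2), (1 - q ^ (n + 1 - k)) * qBinom q (n + 1) k * x ^ k := by
    have : rogersSzego q x n = ∑ k ∈ range (n + 2), qBinom q n k * x ^ k := by
      rw [sum_range_succ, qBinom_of_lt q (by omega : n < n + 1), rogersSzego]
      ring
    rw [this, mul_sum]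
    refine sum_congr rfl fun k hk => ?_
    rw [one_sub_pow_mul_qBinom hq (by simp at hk; omega), mul_assoc]
  have h3 : ∑ k ∈ range (n + 2), q ^ (n + 1 - k) * qBinom q (n + 1) k * x ^ (k + 1) =
      x * rogersSzego q x (n + 1) - x * ((1 - q ^ (n + 1)) * rogersSzego q x n) := by
    rw [h2, rogersSzego, mul_sum, mul_sum, ← sum_sub_distrib]
    exact sum_congr rfl fun k _ => by ring
  rw [rogersSzego, sum_range_succ', qBinom_zero_right hq]
  simp only [qBinom_succ_succ hq (n + 1), add_mul, sum_add_distrib]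
  linear_combination h1 + h3

/-! ### The level 3 Bailey pair through cube roots of unity -/

theorem sum_range_two_mul_add_one (f : ℕ → ℂ) (n : ℕ) :
    ∑ k ∈ range (2 * n + 1), f k =
      f n + ∑ s ∈ range n, (f (n - (s + 1)) + f (n + (s + 1))) := by
  rw [show 2 * n + 1 = n + (n + 1) by ring, sum_range_add, sum_range_succ', sum_add_distrib,
    ← sum_range_reflect f n]
  have : ∀ s, n - 1 - s = n - (s + 1) := fun s => by omega
  simp only [this, add_zero]
  ring

theorem alpha_three (q : ℂ) (n : ℕ) :
    alpha 3 q n = if n = 0 then 1 else if n % 3 = 0 then 2 else -1 := by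
  simp only [alpha, alphaExp]
  norm_num

theorem norm_alpha_three_le (q : ℂ) (n : ℕ) : ‖alpha 3 q n‖ ≤ 2 := by
  rw [alpha_three]
  split_ifs <;> norm_num

theorem alpha_three_of_pos {w : ℂ} (hw : w ^ 2 + w + 1 = 0) (q : ℂ) {n : ℕ} (hn : 0 < n) :
    alpha 3 q n = w ^ (2 * n) + w ^ n := by
  have h3 : w ^ 3 = 1 := by linear_combination (w - 1) * hw
  rw [alpha_three, if_neg hn.ne']
  have hd := Nat.div_add_mod n 3
  have hlt := Nat.mod_lt n (by norm_num : 0 < 3)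
  generalize n / 3 = d at hd
  generalize n % 3 = e at hd hlt
  subst hd
  have : w ^ (3 * d) = 1 := by rw [pow_mul, h3, one_pow]
  rw [mul_comm 2, pow_mul, pow_add, this]
  interval_cases e <;> norm_num
  · linear_combination -hw
  · linear_combination (-w * w + w - 1) * hw

/-- A sum over `-n ≤ s ≤ n` weighted by powers of a cube root of unity, folded onto `0 ≤ s ≤ n`. -/
theorem sum_qBinom_mul_pow_eq {w : ℂ} (hw : w ^ 2 + w + 1 = 0) (q q' : ℂ) (u : ℕ → ℂ) (n : ℕ) :
    ∑ k ∈ range (2 * n + 1), qBinom q (2 * n) k * w ^ (2 * n + k) * u ((k : ℤ) - n).natAbs =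
      qPoch q q (2 * n) *
        ∑ s ∈ range (n + 1), alpha 3 q' s * u s / (qPoch q q (n - s) * qPoch q q (n + s)) := by
  have h3 : ∀ j, w ^ (3 * j) = 1 := fun j => by
    rw [pow_mul, show w ^ 3 = 1 by linear_combination (w - 1) * hw, one_pow]
  -- Since `w^(3n) = 1`, the weight `w^(2n+k)` is `w^(k-n)`; pairing `k = n - s` with `k = n + s`
  -- produces `α_s`.
  rw [sum_range_two_mul_add_one, sum_range_succ', mul_add, mul_sum, add_comm]
  congr 1
  · refine sum_congr rfl fun s hs => ?_
    obtain ⟨j, rfl⟩ := Nat.exists_eq_add_of_lt (mem_range.mp hs)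
    have e1 : s + j + 1 - (s + 1) = j := by omega
    have e2 : s + j + 1 + (s + 1) = 2 * s + 2 + j := by ring
    have e3 : 2 * (s + j + 1) = j + (2 * s + 2 + j) := by ring
    rw [e1, e2, e3, qBinom_add, show j + (2 * s + 2 + j) = (2 * s + 2 + j) + j by ring,
      qBinom_add, alpha_three_of_pos hw q' (by omega : 0 < s + 1),
      show ((j : ℤ) - (s + j + 1 : ℕ)).natAbs = s + 1 by omega,
      show (((2 * s + 2 + j : ℕ) : ℤ) - (s + j + 1 : ℕ)).natAbs = s + 1 by omega,
      show 2 * s + 2 + j + j + j = 3 * j + 2 * (s + 1) by ring,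
      show 2 * s + 2 + j + j + (2 * s + 2 + j) = 3 * (j + s + 1) + (s + 1) by ring,
      pow_add w, pow_add w, h3, h3]
    ring
  · rw [show 2 * n = n + n by ring, qBinom_add, alpha_three, ← two_mul, ← add_one_mul,
      show (2 + 1) * n = 3 * n by ring, h3]
    simp
    ring

theorem beta_three_natCast_mul {w : ℂ} (hw : w ^ 2 + w + 1 = 0) (q : ℂ) (n : ℕ) :
    qPoch q q (2 * n) * beta 3 q n = w ^ (2 * n) * rogersSzego q w (2 * n) := by
  have h := sum_qBinom_mul_pow_eq hw q q (fun _ => 1) n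
  rw [beta, rogersSzego, mul_sum (s := range (2 * n + 1))]
  rw [show ((n : ℤ) + 1).toNat = n + 1 by omega]
  have h1 : ∀ s : ℕ, ((n : ℤ) - s).toNat = n - s := fun s => by omega
  have h2 : ∀ s : ℕ, ((n : ℤ) + s).toNat = n + s := fun s => by omega
  simp only [h1, h2, mul_one] at h ⊢
  rw [← h]
  exact sum_congr rfl fun k _ => by ring

/-! ### Cubic expansion of the Rogers–Szegő polynomials at `w` -/

/-- The Rogers–Szegő polynomial at a cube root of unity `w`, normalized to be rational in `q`. -/
noncomputable def cubicSzego (w q : ℂ) (n : ℕ) : ℂ :=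
  w ^ n * rogersSzego q w n

section

variable {w : ℂ} (hw : w ^ 2 + w + 1 = 0) {q : ℂ} (hq : ‖q‖ < 1)
include hw hq

/-- The normalization turns the coefficients `1 + w` and `w` into `w(1 + w) = -1` and `w³ = 1`. -/
theorem cubicSzego_succ_succ (n : ℕ) :
    cubicSzego w q (n + 2) = -cubicSzego w q (n + 1) - (1 - q ^ (n + 1)) * cubicSzego w q n := by
  simp only [cubicSzego, rogersSzego_succ_succ hq]
  have h3 : w ^ 3 = 1 := by linear_combination (w - 1) * hw
  simp only [pow_succ]
  linear_combination (w ^ n * w * rogersSzego q w (n + 1)) * hw -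
    (1 - q ^ n * q) * w ^ n * rogersSzego q w n * h3

end

/-- The `r`-th term of the cubic expansion of `cubicSzego`. -/
noncomputable def cubicTerm (q : ℂ) (M r : ℕ) : ℂ :=
  qBinom (q ^ 3) M r * ((-1) ^ r * q ^ ((3 * r ^ 2 + r) / 2)) *
    qPoch (q ^ (3 * r + 1)) (q ^ 3) (M - r)

theorem half_exponent_succ (r : ℕ) :
    (3 * (r + 1) ^ 2 + (r + 1)) / 2 = (3 * r ^ 2 + r) / 2 + (3 * r + 2) := by
  rw [show 3 * (r + 1) ^ 2 + (r + 1) = 3 * r ^ 2 + r + (3 * r + 2) * 2 by ring,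
    Nat.add_mul_div_right _ _ (by norm_num)]

theorem qPoch_self_three_mul (n : ℕ) :
    qPoch q q (3 * n) = qPoch q (q ^ 3) n * qPoch (q ^ 2) (q ^ 3) n * qPoch (q ^ 3) (q ^ 3) n := by
  induction n with
  | zero => simp [qPoch_zero]
  | succ n ih =>
    rw [show 3 * (n + 1) = 3 * n + 1 + 1 + 1 by ring]
    simp only [qPoch_succ, ih]
    ring

/-- The sum of the cubic expansion of `cubicSzego` at `3M`. -/
noncomputable def cubicSum (q : ℂ) (M : ℕ) : ℂ :=
  ∑ r ∈ range (M + 1), cubicTerm q M r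

/-- Up to the factor `-(1 - q^(3M+1))`, the expansion of `cubicSzego` at `3M+1`. -/
noncomputable def cubicSum' (q : ℂ) (M : ℕ) : ℂ :=
  ∑ r ∈ range (M + 1), cubicTerm q M r / (1 - q ^ (3 * r + 1))

section

variable {q : ℂ} (hq : ‖q‖ < 1)
include hq

theorem cubicTerm_succ {M r : ℕ} (h : r ≤ M) :
    cubicTerm q (M + 1) r * (1 - q ^ (3 * (M + 1 - r))) =
      (1 - q ^ (3 * (M + 1))) * (1 - q ^ (3 * M + 1)) * cubicTerm q M r := by
  have hb := one_sub_pow_mul_qBinom (norm_pow_lt_one hq three_ne_zero) (by omega : r ≤ M + 1)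
  rw [← pow_mul, ← pow_mul] at hb
  simp only [cubicTerm]
  rw [show M + 1 - r = (M - r) + 1 by omega, qPoch_succ, ← pow_mul, ← pow_add,
    show 3 * r + 1 + 3 * (M - r) = 3 * M + 1 by omega]
  rw [show M + 1 - r = (M - r) + 1 by omega] at hb
  linear_combination ((-1) ^ r * q ^ ((3 * r ^ 2 + r) / 2)) *
    qPoch (q ^ (3 * r + 1)) (q ^ 3) (M - r) * (1 - q ^ (3 * M + 1)) * hb

/-- Holds term by term: `(1 - q^(3M+4))/(1 - q^(3r+1)) - 1` contains the factor `1 - q^(3(M+1-r))`,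
which kills `r = M + 1` and is what `cubicTerm_succ` needs for the other terms. -/
theorem cubicSum'_succ_sub (M : ℕ) :
    (1 - q ^ (3 * M + 4)) * cubicSum' q (M + 1) - cubicSum q (M + 1) =
      (1 - q ^ (3 * M + 3)) * ((1 - q ^ (3 * M + 1)) * (cubicSum' q M - cubicSum q M)) := by
  simp only [cubicSum, cubicSum']
  rw [mul_sum, ← sum_sub_distrib, ← sum_sub_distrib, mul_sum, mul_sum, sum_range_succ]
  have h0 := one_sub_pow_ne_zero hq (by omega : 3 * (M + 1) + 1 ≠ 0)
  have hlast : (1 - q ^ (3 * M + 4)) * (cubicTerm q (M + 1) (M + 1) / (1 - q ^ (3 * (M + 1) + 1)))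
      - cubicTerm q (M + 1) (M + 1) = 0 := by
    rw [show 3 * M + 4 = 3 * (M + 1) + 1 by ring]
    field_simp
    ring
  rw [hlast, add_zero]
  refine sum_congr rfl fun r hr => ?_
  have hr : r ≤ M := by simp at hr; omega
  have h1 := one_sub_pow_ne_zero hq (by omega : 3 * r + 1 ≠ 0)
  have h := cubicTerm_succ hq hr
  obtain ⟨j, rfl⟩ := Nat.exists_eq_add_of_le hr
  rw [show r + j + 1 - r = j + 1 by omega] at h
  field_simp
  ring_nf at h ⊢
  linear_combination q * q ^ (r * 3) * h

theorem cubicTerm_succ_succ (M r : ℕ) (hr : r ≤ M) :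
    cubicTerm q (M + 1) (r + 1) =
      qBinom (q ^ 3) M (r + 1) * ((-1) ^ (r + 1) * q ^ ((3 * (r + 1) ^ 2 + (r + 1)) / 2)) *
        qPoch (q ^ (3 * (r + 1) + 1)) (q ^ 3) (M + 1 - (r + 1)) -
      q ^ (3 * M + 2) * ((1 - q ^ (3 * M + 1)) * (cubicTerm q M r / (1 - q ^ (3 * r + 1)))) := by
  have h1 := one_sub_pow_ne_zero hq (by omega : 3 * r + 1 ≠ 0)
  have h2 := qPoch_succ' (q ^ (3 * r + 1)) (q ^ 3) (M - r)
  rw [qPoch_succ, ← pow_mul, ← pow_add, ← pow_add] at h2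
  simp only [cubicTerm]
  rw [qBinom_succ_succ (norm_pow_lt_one hq three_ne_zero), half_exponent_succ,
    show M + 1 - (r + 1) = M - r by omega, show 3 * (r + 1) + 1 = 3 * r + 1 + 3 by ring,
    add_mul, add_mul, sub_eq_add_neg]
  congr 1
  rw [eq_div_of_mul_eq h1 ((mul_comm _ _).trans h2.symm)]
  obtain ⟨j, rfl⟩ := Nat.exists_eq_add_of_le hr
  rw [show r + j - r = j by omega, ← pow_mul]
  field_simp
  ring

/-- Pascal's rule in base `q³` splits each term. One half only gains the Pochhammer factor `1 -
q^(3M+1)`. In the other, after a shift of `r`, the powers `q^(3r+2)` and `q^(3(M-r))` combine to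
`q^(3M+2)`, while the Pochhammer symbol trades its first factor `1 - q^(3r+1)` for `1 - q^(3M+1)`.
-/
theorem cubicSum_succ (M : ℕ) :
    cubicSum q (M + 1) =
      (1 - q ^ (3 * M + 1)) * cubicSum q M -
        q ^ (3 * M + 2) * ((1 - q ^ (3 * M + 1)) * cubicSum' q M) := by
  have hQ := norm_pow_lt_one hq three_ne_zero
  set g : ℕ → ℂ := fun r => qBinom (q ^ 3) M r * ((-1) ^ r * q ^ ((3 * r ^ 2 + r) / 2)) *
        qPoch (q ^ (3 * r + 1)) (q ^ 3) (M + 1 - r) with hg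
  have h1 : (1 - q ^ (3 * M + 1)) * cubicSum q M = ∑ r ∈ range (M + 2), g r := by
    rw [sum_range_succ, cubicSum, mul_sum]
    have : g (M + 1) = 0 := by simp only [hg]; rw [qBinom_of_lt _ (Nat.lt_succ_self M)]; simp
    rw [this, add_zero]
    refine sum_congr rfl fun r hr => ?_
    have hr : r ≤ M := by simp at hr; omega
    simp only [hg, cubicTerm]
    rw [show M + 1 - r = (M - r) + 1 by omega, qPoch_succ, ← pow_mul, ← pow_add,
      show 3 * r + 1 + 3 * (M - r) = 3 * M + 1 by omega]
    ring
  have h0 : cubicTerm q (M + 1) 0 = g 0 := by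
    simp only [hg, cubicTerm, qBinom_zero_right hQ]
  rw [h1, cubicSum, cubicSum', mul_sum, mul_sum, sum_range_succ', sum_range_succ' g, h0,
    sum_congr rfl fun r hr =>
      cubicTerm_succ_succ hq M r (Nat.lt_succ_iff.mp (mem_range.mp hr)), sum_sub_distrib]
  ring

/-- Three steps of the recurrence, with the value at `3M+2` eliminated, give exactly the relations
`cubicSum_succ` and `cubicSum'_succ_sub`. -/
theorem cubicSzego_three_mul {w : ℂ} (hw : w ^ 2 + w + 1 = 0) (M : ℕ) :
    cubicSzego w q (3 * M) = cubicSum q M ∧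
      cubicSzego w q (3 * M + 1) = -((1 - q ^ (3 * M + 1)) * cubicSum' q M) := by
  induction M with
  | zero =>
    have h1 : 1 - q ≠ 0 := one_sub_ne_zero hq
    have h3 := norm_pow_lt_one hq three_ne_zero
    constructor
    · simp [cubicSzego, rogersSzego, cubicSum, cubicTerm, qBinom_zero_right hq,
        qBinom_zero_right h3, qPoch_zero]
    · have : rogersSzego q w 1 = 1 + w := by
        rw [rogersSzego, sum_range_succ, sum_range_one, qBinom_zero_right hq, qBinom_self hq]
        ring
      simp only [cubicSzego, cubicSum', cubicTerm, mul_zero, zero_add, this, sum_range_one,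
        qBinom_zero_right h3, Nat.sub_self, qPoch_zero, pow_one, pow_zero]
      norm_num
      rw [mul_inv_cancel₀ h1]
      linear_combination hw
  | succ M ih =>
    obtain ⟨h0, h1⟩ := ih
    have h2 := cubicSzego_succ_succ hw hq (3 * M)
    have h3 := cubicSzego_succ_succ hw hq (3 * M + 1)
    have h4 := cubicSzego_succ_succ hw hq (3 * M + 2)
    have hX := cubicSum_succ hq M
    have hY := cubicSum'_succ_sub hq M
    have e : cubicSzego w q (3 * (M + 1)) = cubicSum q (M + 1) := by
      rw [show 3 * (M + 1) = 3 * M + 1 + 2 by ring, h3, h2, h0, h1, hX]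
      ring
    refine ⟨e, ?_⟩
    rw [show 3 * (M + 1) + 1 = 3 * M + 2 + 2 by ring, h4, show 3 * M + 2 + 1 = 3 * (M + 1) by ring,
      e, h2, h0, h1]
    rw [show 3 * M + 2 + 2 = 3 * M + 4 by ring, show 3 * (M + 1) = 3 * M + 3 by ring]
    linear_combination hY

/-! ### Explicit formulas for `β` at `3m` and `3m ± 1` -/

theorem sigma_mul_qPoch {m r : ℕ} (hr : r ≤ 2 * m) :
    qPoch q q (6 * m) * sigma q m r = cubicTerm q (2 * m) r := by
  have hQ := norm_pow_lt_one hq three_ne_zero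
  have h2 := norm_pow_lt_one hq two_ne_zero
  have e1 : qPoch q (q ^ 3) (2 * m) =
      qPoch q (q ^ 3) r * qPoch (q ^ (3 * r + 1)) (q ^ 3) (2 * m - r) := by
    conv_lhs => rw [show 2 * m = r + (2 * m - r) by omega, qPoch_add]
    rw [← pow_mul, ← pow_succ']
  rw [sigma, cubicTerm, qBinom, if_pos hr, show 6 * m = 3 * (2 * m) by ring,
    qPoch_self_three_mul, qPoch_self_three_mul, e1]
  have n1 := qPoch_ne_zero hq hQ r
  have n2 := qPoch_ne_zero h2 hQ r
  have n3 := qPoch_ne_zero hQ hQ r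
  have n4 := qPoch_ne_zero h2 hQ (2 * m)
  have n5 := qPoch_ne_zero hQ hQ (2 * m - r)
  field_simp

theorem sum_sigma_mul (m : ℕ) (c : ℕ → ℂ) :
    qPoch q q (6 * m) * ∑ r ∈ range (2 * m + 1), sigma q m r * c r =
      ∑ r ∈ range (2 * m + 1), cubicTerm q (2 * m) r * c r := by
  rw [mul_sum]
  refine sum_congr rfl fun r hr => ?_
  rw [← mul_assoc, sigma_mul_qPoch hq (Nat.lt_succ_iff.mp (mem_range.mp hr))]

variable {w : ℂ} (hw : w ^ 2 + w + 1 = 0)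
include hw

theorem beta_three_mul (m : ℕ) :
    beta 3 q (3 * (m : ℤ)) = ∑ r ∈ range (2 * m + 1), sigma q m r := by
  have h := beta_three_natCast_mul hw q (3 * m)
  have hc := (cubicSzego_three_mul hq hw (2 * m)).1
  rw [cubicSzego, show 3 * (2 * m) = 2 * (3 * m) by ring, ← h,
    show 2 * (3 * m) = 6 * m by ring] at hc
  have hs := sum_sigma_mul hq m fun _ => 1
  simp only [mul_one] at hs
  rw [cubicSum, ← hs] at hc
  push_cast at hc
  exact mul_left_cancel₀ (qPoch_ne_zero hq hq _) hc

theorem beta_three_mul_add_one (m : ℕ) :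
    beta 3 q (3 * (m : ℤ) + 1) = ∑ r ∈ range (2 * m + 1),
      sigma q m r * (1 / (1 - q ^ (6 * m + 2)) * (1 / (1 - q ^ (3 * r + 1)) - 1)) := by
  have h := beta_three_natCast_mul hw q (3 * m + 1)
  obtain ⟨hc0, hc1⟩ := cubicSzego_three_mul hq hw (2 * m)
  have hc := cubicSzego_succ_succ hw hq (3 * (2 * m))
  rw [hc0, hc1, cubicSzego, show 3 * (2 * m) + 2 = 2 * (3 * m + 1) by ring, ← h,
    show 2 * (3 * m + 1) = 6 * m + 1 + 1 by ring, qPoch_self_succ, qPoch_self_succ] at hc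
  have hs := sum_sigma_mul hq m
    fun r => 1 / (1 - q ^ (6 * m + 2)) * (1 / (1 - q ^ (3 * r + 1)) - 1)
  have n0 := one_sub_pow_ne_zero hq (by omega : 6 * m + 1 ≠ 0)
  have n1 := one_sub_pow_ne_zero hq (by omega : 6 * m + 2 ≠ 0)
  have e : ∑ r ∈ range (2 * m + 1), cubicTerm q (2 * m) r *
      (1 / (1 - q ^ (6 * m + 2)) * (1 / (1 - q ^ (3 * r + 1)) - 1)) =
      1 / (1 - q ^ (6 * m + 2)) * (cubicSum' q (2 * m) - cubicSum q (2 * m)) := by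
    rw [cubicSum, cubicSum', ← sum_sub_distrib, mul_sum]
    exact sum_congr rfl fun r _ => by ring
  rw [e] at hs
  refine mul_left_cancel₀ (qPoch_ne_zero hq hq (6 * m)) ?_
  rw [hs, one_div, eq_inv_mul_iff_mul_eq₀ n1]
  refine mul_left_cancel₀ n0 ?_
  push_cast at hc
  rw [show 6 * m + 1 + 1 = 6 * m + 2 by ring, show 3 * (2 * m) + 1 = 6 * m + 1 by ring] at hc
  linear_combination hc

/-- The recurrence is run backwards from the indices `6m` and `6m+1` to `6m-2`. -/
theorem beta_three_mul_sub_one (m : ℕ) :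
    beta 3 q (3 * (m : ℤ) - 1) = ∑ r ∈ range (2 * m + 1),
      sigma q m r * (q ^ (6 * m) - (1 - q ^ (6 * m + 1)) / (1 - q ^ (3 * r + 1))) := by
  have hs := sum_sigma_mul hq m
    fun r => q ^ (6 * m) - (1 - q ^ (6 * m + 1)) / (1 - q ^ (3 * r + 1))
  have e : ∑ r ∈ range (2 * m + 1), cubicTerm q (2 * m) r *
      (q ^ (6 * m) - (1 - q ^ (6 * m + 1)) / (1 - q ^ (3 * r + 1))) =
      q ^ (6 * m) * cubicSum q (2 * m) - (1 - q ^ (6 * m + 1)) * cubicSum' q (2 * m) := by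
    rw [cubicSum, cubicSum', mul_sum, mul_sum, ← sum_sub_distrib]
    exact sum_congr rfl fun r _ => by ring
  rw [e] at hs
  refine mul_left_cancel₀ (qPoch_ne_zero hq hq (6 * m)) ?_
  rw [hs]
  obtain ⟨hc0, hc1⟩ := cubicSzego_three_mul hq hw (2 * m)
  -- For `m = 0` there is no index `6m-2`; both sides vanish, `β_{-1}` being an empty sum.
  rcases m with _ | m
  · have h1 : 1 - q ≠ 0 := one_sub_ne_zero hq
    simp [beta, cubicSum, cubicSum', cubicTerm, qPoch_zero,
      qBinom_zero_right (norm_pow_lt_one hq three_ne_zero), h1]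
  · have h := beta_three_natCast_mul hw q (3 * m + 2)
    have hβ : cubicSzego w q (6 * m + 4) =
        qPoch q q (6 * m + 4) * beta 3 q ((3 * m + 2 : ℕ) : ℤ) := by
      rw [cubicSzego, show 6 * m + 4 = 2 * (3 * m + 2) by ring, h]
    have h2 := cubicSzego_succ_succ hw hq (6 * m + 4)
    have h3 := cubicSzego_succ_succ hw hq (6 * m + 5)
    rw [show 6 * m + 5 + 2 = 3 * (2 * (m + 1)) + 1 by ring,
      show 6 * m + 5 + 1 = 3 * (2 * (m + 1)) by ring, hc0, hc1] at h3
    rw [show 6 * m + 4 + 2 = 3 * (2 * (m + 1)) by ring, hc0, hβ] at h2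
    rw [show 3 * (((m + 1 : ℕ) : ℤ)) - 1 = ((3 * m + 2 : ℕ) : ℤ) by push_cast; ring,
      show 6 * (m + 1) = 6 * m + 4 + 1 + 1 by ring, qPoch_self_succ, qPoch_self_succ]
    rw [show 3 * (2 * (m + 1)) = 6 * m + 6 by ring] at h3
    ring_nf at h2 h3 ⊢
    linear_combination (1 - q ^ 6 * q ^ (m * 6)) * h2 - h3

end

/-! ### Infinite product identities -/

theorem tendsto_qPoch (a : ℂ) {q : ℂ} (hq : ‖q‖ < 1) :
    Tendsto (qPoch a q) atTop (𝓝 (qPochInf a q)) :=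
  (multipliable_qPochInf a q hq).tendsto_prod_tprod_nat

theorem qPoch_mul (a q : ℂ) (k n : ℕ) :
    qPoch a q (k * n) = ∏ i ∈ range k, qPoch (a * q ^ i) (q ^ k) n := by
  induction n with
  | zero => simp [qPoch_zero]
  | succ n ih =>
    simp only [qPoch_succ, prod_mul_distrib]
    rw [← ih, Nat.mul_succ, qPoch_add]
    congr 1
    exact prod_congr rfl fun i _ => by ring

theorem qPochInf_eq_prod (a : ℂ) {q : ℂ} (hq : ‖q‖ < 1) {k : ℕ} (hk : k ≠ 0) :
    qPochInf a q = ∏ i ∈ range k, qPochInf (a * q ^ i) (q ^ k) := by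
  have h1 : Tendsto (fun n => qPoch a q (k * n)) atTop (𝓝 (qPochInf a q)) :=
    (tendsto_qPoch a hq).comp (tendsto_id.const_mul_atTop' (Nat.pos_of_ne_zero hk))
  have h2 : Tendsto (fun n => ∏ i ∈ range k, qPoch (a * q ^ i) (q ^ k) n) atTop
      (𝓝 (∏ i ∈ range k, qPochInf (a * q ^ i) (q ^ k))) :=
    tendsto_finsetProd _ fun i _ => tendsto_qPoch _ (norm_pow_lt_one hq hk)
  simp only [← qPoch_mul] at h2
  exact tendsto_nhds_unique h1 h2

theorem qPochInf_mul_neg (a : ℂ) {q : ℂ} (hq : ‖q‖ < 1) :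
    qPochInf a q * qPochInf (-a) q = qPochInf (a ^ 2) (q ^ 2) := by
  have h := (tendsto_qPoch a hq).mul (tendsto_qPoch (-a) hq)
  refine tendsto_nhds_unique h
    ((tendsto_qPoch (a ^ 2) (norm_pow_lt_one hq two_ne_zero)).congr fun n => ?_)
  simp only [qPoch, ← prod_mul_distrib]
  exact prod_congr rfl fun k _ => by ring

/-- Euler's identity for partitions into distinct and odd parts. -/
theorem qPochInf_neg_self_mul {q : ℂ} (hq : ‖q‖ < 1) :
    qPochInf (-q) q * qPochInf q (q ^ 2) = 1 := by
  have h1 := qPochInf_mul_neg q hq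
  have h2 := qPochInf_eq_prod q hq two_ne_zero
  have hn := qPochInf_ne_zero_of_norm_lt (norm_pow_lt_one hq two_ne_zero)
    (norm_pow_lt_one hq two_ne_zero)
  simp only [prod_range_succ, prod_range_zero, pow_zero, pow_one, mul_one, one_mul, ← sq] at h2
  rw [h2] at h1
  exact mul_right_cancel₀ hn (by linear_combination h1)

/-- Euler's identity in `q²` inverts `(q²;q⁴)_∞ = (q²,q⁶,q¹⁰;q¹²)_∞`, and `(q³;q⁶)_∞ (-q³;q⁶)_∞`
supplies the missing `(q⁶;q¹²)_∞`. -/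
theorem product_mul_eq_one {q : ℂ} (hq : ‖q‖ < 1) :
    (qPochInf (q ^ 2) (q ^ 12) * qPochInf (q ^ 3) (q ^ 12) *
        qPochInf (q ^ 9) (q ^ 12) * qPochInf (q ^ 10) (q ^ 12)) *
      (qPochInf (-q ^ 2) (q ^ 2) * qPochInf (-q ^ 3) (q ^ 6)) = 1 := by
  have hp : ∀ n : ℕ, n ≠ 0 → ‖q ^ n‖ < 1 := fun n hn => norm_pow_lt_one hq hn
  have h1 := qPochInf_neg_self_mul (hp 2 (by norm_num))
  have h2 := qPochInf_eq_prod (q ^ 2) (hp 4 (by norm_num)) three_ne_zero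
  have h3 := qPochInf_mul_neg (q ^ 3) (hp 6 (by norm_num))
  have h4 := qPochInf_eq_prod (q ^ 3) (hp 6 (by norm_num)) two_ne_zero
  simp only [prod_range_succ, prod_range_zero, one_mul, ← pow_mul, ← pow_add] at h1 h2 h3 h4
  norm_num at h1 h2 h3 h4
  rw [h2] at h1
  rw [h4] at h3
  rw [← h3] at h1
  linear_combination h1

/-- Split `(q)_∞` modulo 6, then the classes 2, 3, 4 modulo 12, and cancel. -/
theorem product_quotient_eq {q : ℂ} (hq : ‖q‖ < 1) :
    qPochInf q (q ^ 6) * qPochInf (q ^ 5) (q ^ 6) * qPochInf (q ^ 6) (q ^ 6) *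
        (qPochInf (q ^ 4) (q ^ 12) * qPochInf (q ^ 8) (q ^ 12)) / qPochInf q q =
      1 / (qPochInf (q ^ 2) (q ^ 12) * qPochInf (q ^ 3) (q ^ 12) *
        qPochInf (q ^ 9) (q ^ 12) * qPochInf (q ^ 10) (q ^ 12)) := by
  have hp : ∀ n : ℕ, n ≠ 0 → ‖q ^ n‖ < 1 := fun n hn => norm_pow_lt_one hq hn
  have h1 := qPochInf_eq_prod q hq (by norm_num : 6 ≠ 0)
  have h2 := qPochInf_eq_prod (q ^ 2) (hp 6 (by norm_num)) two_ne_zero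
  have h3 := qPochInf_eq_prod (q ^ 3) (hp 6 (by norm_num)) two_ne_zero
  have h4 := qPochInf_eq_prod (q ^ 4) (hp 6 (by norm_num)) two_ne_zero
  simp only [prod_range_succ, prod_range_zero, one_mul, mul_one, ← pow_mul, ← pow_add,
    ← pow_succ'] at h1 h2 h3 h4
  norm_num at h1 h2 h3 h4
  have n0 := qPochInf_ne_zero_of_norm_lt hq hq
  have n12 : ∀ k : ℕ, k ≠ 0 → qPochInf (q ^ k) (q ^ 12) ≠ 0 := fun k hk =>
    qPochInf_ne_zero_of_norm_lt (hp k hk) (hp 12 (by norm_num))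
  have a2 := n12 2 (by norm_num)
  have a3 := n12 3 (by norm_num)
  have a9 := n12 9 (by norm_num)
  have a10 := n12 10 (by norm_num)
  rw [div_eq_div_iff n0 (by simp [a2, a3, a9, a10]), h1, h2, h3, h4, one_mul]
  ring

/-! ### Finite Jacobi triple product -/

theorem sq_natAbs_sub_add {n m k : ℕ} (h : k ≤ n + m) :
    2 * (n + m - k) + ((((k + 1 : ℕ) : ℤ)) - n).natAbs ^ 2 =
      ((k : ℤ) - n).natAbs ^ 2 + (2 * m + 1) := by
  zify [h]
  simp only [sq_abs]
  ring

theorem sq_natAbs_sub_add' (n k : ℕ) :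
    2 * (k + 1) + ((k : ℤ) - n).natAbs ^ 2 =
      ((((k + 1 : ℕ) : ℤ)) - n).natAbs ^ 2 + (2 * n + 1) := by
  zify
  simp only [sq_abs]
  ring

theorem exists_sq_add_self_add_one_eq_zero : ∃ w : ℂ, w ^ 2 + w + 1 = 0 := by
  have h := (Complex.isPrimitiveRoot_exp 3 three_ne_zero).geom_sum_eq_zero (by norm_num)
  simp only [sum_range_succ, sum_range_zero, pow_zero, pow_one] at h
  exact ⟨_, by linear_combination h⟩

section

variable {q : ℂ} (hq : ‖q‖ < 1)
include hq

/-- The finite form of Jacobi's triple product identity. -/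
theorem finite_jacobi_triple_product (x : ℂ) (n m : ℕ) :
    (∏ k ∈ range n, (x + q ^ (2 * k + 1))) * ∏ k ∈ range m, (1 + x * q ^ (2 * k + 1)) =
      ∑ k ∈ range (n + m + 1),
        qBinom (q ^ 2) (n + m) k * x ^ k * q ^ (((k : ℤ) - n).natAbs ^ 2) := by
  have h2 := norm_pow_lt_one hq two_ne_zero
  -- The two families of factors are added separately, each by its own form of Pascal's rule; a new
  -- factor `x + q^(2n+1)` also moves the centre of the exponent.
  induction m with
  | zero =>
    induction n with
    | zero => simp [qBinom_zero_right h2]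
    | succ n ih =>
      simp only [prod_range_zero, mul_one, add_zero] at ih ⊢
      rw [prod_range_succ, ih, sum_range_succ' _ (n + 1), mul_add]
      have hx : ∀ k ∈ range (n + 1), qBinom (q ^ 2) (n + 1) (k + 1) * x ^ (k + 1) *
          q ^ ((((k + 1 : ℕ) : ℤ) - (n + 1 : ℕ)).natAbs ^ 2) =
          qBinom (q ^ 2) n (k + 1) * x ^ (k + 1) * q ^ ((((k + 1 : ℕ) : ℤ) - n).natAbs ^ 2) *
            q ^ (2 * n + 1) +
          qBinom (q ^ 2) n k * x ^ k * q ^ (((k : ℤ) - n).natAbs ^ 2) * x := fun k _ => by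
        rw [qBinom_succ_succ' h2, show ((k + 1 : ℕ) : ℤ) - (n + 1 : ℕ) = k - n by push_cast; ring,
          mul_assoc _ (q ^ _) (q ^ (2 * n + 1)), ← pow_add, ← sq_natAbs_sub_add' n k,
          pow_add q, pow_mul q]
        ring
      rw [sum_congr rfl hx, sum_add_distrib, ← sum_mul, ← sum_mul]
      have hs := sum_range_succ'
        (fun k : ℕ => qBinom (q ^ 2) n k * x ^ k * q ^ (((k : ℤ) - n).natAbs ^ 2)) (n + 1)
      rw [sum_range_succ, qBinom_of_lt _ (Nat.lt_succ_self n)] at hs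
      have h0 : qBinom (q ^ 2) (n + 1) 0 * x ^ 0 *
          q ^ ((((0 : ℕ) : ℤ) - (n + 1 : ℕ)).natAbs ^ 2) =
          qBinom (q ^ 2) n 0 * x ^ 0 * q ^ ((((0 : ℕ) : ℤ) - n).natAbs ^ 2) *
            q ^ (2 * n + 1) := by
        rw [qBinom_zero_right h2, qBinom_zero_right h2, mul_assoc _ (q ^ _) (q ^ (2 * n + 1)),
          ← pow_add]
        congr 2
        zify
        simp only [sq_abs]
        ring
      rw [h0]
      linear_combination q ^ (2 * n + 1) * hs
  | succ m ih =>
    rw [prod_range_succ, ← mul_assoc, ih, ← add_assoc, sum_range_succ' _ (n + m + 1)]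
    have hx : ∀ k ∈ range (n + m + 1), qBinom (q ^ 2) (n + m + 1) (k + 1) * x ^ (k + 1) *
        q ^ ((((k + 1 : ℕ) : ℤ) - n).natAbs ^ 2) =
        qBinom (q ^ 2) (n + m) (k + 1) * x ^ (k + 1) * q ^ ((((k + 1 : ℕ) : ℤ) - n).natAbs ^ 2) +
        qBinom (q ^ 2) (n + m) k * x ^ k * q ^ (((k : ℤ) - n).natAbs ^ 2) *
          (x * q ^ (2 * m + 1)) := fun k hk => by
      have he := sq_natAbs_sub_add (n := n) (m := m) (Nat.lt_succ_iff.mp (mem_range.mp hk))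
      have : q ^ (((k : ℤ) - n).natAbs ^ 2) * q ^ (2 * m + 1) =
          (q ^ 2) ^ (n + m - k) * q ^ ((((k + 1 : ℕ) : ℤ) - n).natAbs ^ 2) := by
        rw [← pow_add, ← he, pow_add q, pow_mul]
      rw [qBinom_succ_succ h2]
      linear_combination -(qBinom (q ^ 2) (n + m) k * x ^ k * x) * this
    rw [sum_congr rfl hx, sum_add_distrib, ← sum_mul]
    have hs := sum_range_succ'
      (fun k : ℕ => qBinom (q ^ 2) (n + m) k * x ^ k * q ^ (((k : ℤ) - n).natAbs ^ 2)) (n + m + 1)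
    rw [sum_range_succ, qBinom_of_lt _ (Nat.lt_succ_self (n + m)), qBinom_zero_right h2] at hs
    rw [qBinom_zero_right h2]
    linear_combination hs

/-- At `x = w`, with `y = q^(2k+1)`, one has `w² (w + y)(1 + w y) = 1 - y + y²`. -/
theorem finite_jacobi_cubic (n : ℕ) :
    qPoch (q ^ 2) (q ^ 2) (2 * n) * ∑ s ∈ range (n + 1), alpha 3 q s * q ^ (s ^ 2) /
        (qPoch (q ^ 2) (q ^ 2) (n - s) * qPoch (q ^ 2) (q ^ 2) (n + s)) =
      ∏ k ∈ range n, (1 - q ^ (2 * k + 1) + q ^ (4 * k + 2)) := by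
  obtain ⟨w, hw⟩ := exists_sq_add_self_add_one_eq_zero
  have h3 : w ^ 3 = 1 := by linear_combination (w - 1) * hw
  rw [← sum_qBinom_mul_pow_eq hw (q ^ 2) q (fun s => q ^ (s ^ 2))]
  have h := finite_jacobi_triple_product hq w n n
  rw [← two_mul, ← prod_mul_distrib] at h
  have h' : ∏ k ∈ range n, (1 - q ^ (2 * k + 1) + q ^ (4 * k + 2)) = w ^ (2 * n) *
      ∏ k ∈ range n, (w + q ^ (2 * k + 1)) * (1 + w * q ^ (2 * k + 1)) := by
    have hc : (w ^ 2) ^ n = ∏ k ∈ range n, w ^ 2 := by simp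
    rw [pow_mul, hc, ← prod_mul_distrib]
    refine prod_congr rfl fun k _ => ?_
    rw [show 4 * k + 2 = (2 * k + 1) * 2 by ring, pow_mul]
    generalize q ^ (2 * k + 1) = y
    linear_combination (-1 - y ^ 2 - w * y) * h3 - y * hw
  rw [h', h, mul_sum]
  exact sum_congr rfl fun k _ => by ring

end

/-! ### Limits: the theta series, Durfee rectangles and Bailey's lemma -/

section

variable {q : ℂ} (hq : ‖q‖ < 1)
include hq

theorem tendsto_inv_qPoch_self :
    Tendsto (fun n => (qPoch q q n)⁻¹) atTop (𝓝 (qPochInf q q)⁻¹) :=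
  (tendsto_qPoch q hq).inv₀ (qPochInf_ne_zero_of_norm_lt hq hq)

theorem exists_norm_inv_qPoch_self_le : ∃ C : ℝ, 0 ≤ C ∧ ∀ n, ‖(qPoch q q n)⁻¹‖ ≤ C := by
  obtain ⟨C, hC⟩ := (tendsto_inv_qPoch_self hq).norm.bddAbove_range
  have h : ∀ n, ‖(qPoch q q n)⁻¹‖ ≤ C := fun n => hC ⟨n, rfl⟩
  exact ⟨C, (norm_nonneg _).trans (h 0), h⟩

theorem summable_norm_pow : Summable fun n : ℕ => ‖q‖ ^ n :=
  summable_geometric_of_lt_one (norm_nonneg q) hq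

theorem norm_pow_le_norm_pow {m n : ℕ} (h : m ≤ n) : ‖q ^ n‖ ≤ ‖q‖ ^ m := by
  rw [norm_pow]
  exact pow_le_pow_of_le_one (norm_nonneg q) hq.le h

theorem norm_div_qPoch_mul_qPoch_le {C : ℝ} (h0 : 0 ≤ C)
    (hC : ∀ n, ‖(qPoch q q n)⁻¹‖ ≤ C) {m e : ℕ} (h : m ≤ e) (i j : ℕ) :
    ‖q ^ e / (qPoch q q i * qPoch q q j)‖ ≤ C * C * ‖q‖ ^ m := by
  rw [div_eq_mul_inv, mul_inv, norm_mul, norm_mul, mul_comm]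
  exact mul_le_mul (mul_le_mul (hC i) (hC j) (norm_nonneg _) h0) (norm_pow_le_norm_pow hq h)
    (norm_nonneg _) (mul_nonneg h0 h0)

/-- Jacobi's triple product identity at a cube root of unity. -/
theorem tsum_alpha_three_mul_pow_sq :
    (∑' s : ℕ, alpha 3 q s * q ^ (s ^ 2)) * qPochInf (-q) (q ^ 2) =
      qPochInf (q ^ 2) (q ^ 2) * qPochInf (-q ^ 3) (q ^ 6) := by
  have h2 := norm_pow_lt_one hq two_ne_zero
  have h6 := norm_pow_lt_one hq (by norm_num : 6 ≠ 0)
  have hne := qPochInf_ne_zero_of_norm_lt h2 h2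
  obtain ⟨C, h0, hC⟩ := exists_norm_inv_qPoch_self_le h2
  set p := q ^ 2 with hp
  have hT : Tendsto (fun n => ∑' s : ℕ, if s ≤ n then
      alpha 3 q s * q ^ (s ^ 2) / (qPoch p p (n - s) * qPoch p p (n + s)) else 0) atTop
      (𝓝 (∑' s : ℕ, alpha 3 q s * q ^ (s ^ 2) / (qPochInf p p * qPochInf p p))) := by
    refine tendsto_tsum_of_dominated_convergence
      (bound := fun s => 2 * (C * C) * ‖q‖ ^ s) ((summable_norm_pow hq).mul_left _)
      (fun s => ?_) (Eventually.of_forall fun n s => ?_)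
    · have t1 := (tendsto_qPoch p h2).comp (tendsto_sub_atTop_nat s)
      have t2 := (tendsto_qPoch p h2).comp (tendsto_add_atTop_nat s)
      refine ((tendsto_const_nhds (x := alpha 3 q s * q ^ (s ^ 2))).div (t1.mul t2)
        (mul_ne_zero hne hne)).congr' ?_
      filter_upwards [eventually_ge_atTop s] with n hn
      rw [if_pos hn]
      rfl
    · split_ifs
      · rw [div_eq_mul_inv, mul_inv, norm_mul, norm_mul, norm_mul]
        calc ‖alpha 3 q s‖ * ‖q ^ s ^ 2‖ * (‖(qPoch p p (n - s))⁻¹‖ * ‖(qPoch p p (n + s))⁻¹‖)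
            ≤ 2 * ‖q‖ ^ s * (C * C) := by
              gcongr
              · exact norm_alpha_three_le q s
              · exact norm_pow_le_norm_pow hq (Nat.le_self_pow two_ne_zero s)
              · exact hC _
              · exact hC _
          _ = 2 * (C * C) * ‖q‖ ^ s := by ring
      · rw [norm_zero]; positivity
  -- Multiplying by `1 + y` turns each factor `1 - y + y²` into `1 + y³`.
  have hfin : ∀ n, qPoch p p (2 * n) * (∑' s : ℕ, if s ≤ n then
      alpha 3 q s * q ^ (s ^ 2) / (qPoch p p (n - s) * qPoch p p (n + s)) else 0) *
      qPoch (-q) (q ^ 2) n = qPoch (-q ^ 3) (q ^ 6) n := fun n => by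
    rw [tsum_eq_sum (s := range (n + 1)) fun s hs => if_neg (by simp at hs; omega),
      sum_congr rfl fun s hs => if_pos (Nat.lt_succ_iff.mp (mem_range.mp hs)),
      finite_jacobi_cubic hq, qPoch, qPoch, ← prod_mul_distrib]
    exact prod_congr rfl fun k _ => by ring
  have hL := ((((tendsto_qPoch p h2).comp (tendsto_id.const_mul_atTop' two_pos)).mul hT).mul
    (tendsto_qPoch (-q) h2)).congr hfin
  have key := tendsto_nhds_unique hL (tendsto_qPoch (-q ^ 3) h6)
  rw [tsum_div_const] at key
  rw [← key]
  field_simp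

/-- The generating function of partitions by Durfee rectangles with side difference `a`. -/
noncomputable def durfeeSum (q : ℂ) (a : ℕ) : ℂ :=
  ∑' j : ℕ, q ^ (j ^ 2 + a * j) / (qPoch q q j * qPoch q q (j + a))

theorem summable_durfee (a b e : ℕ) :
    Summable fun j : ℕ => q ^ (j ^ 2 + a * j + e) / (qPoch q q j * qPoch q q (j + b)) := by
  obtain ⟨C, h0, hC⟩ := exists_norm_inv_qPoch_self_le hq
  refine Summable.of_norm_bounded ((summable_norm_pow hq).mul_left (C * C)) fun j => ?_
  exact norm_div_qPoch_mul_qPoch_le hq h0 hC (by nlinarith [Nat.le_self_pow two_ne_zero j]) _ _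

/-- Over the common denominator the numerator contains `1 - q^(j+a+1) - q^j`. The part with `1 -
q^j` vanishes at `j = 0`, and shifting `j` makes it `q^(a+1)` times the sum at `a + 2`; the rest is
`-q^(a+1)` times the sum at `a + 1`. -/
theorem durfeeSum_sub_succ (a : ℕ) :
    durfeeSum q a - durfeeSum q (a + 1) =
      -q ^ (a + 1) * (durfeeSum q (a + 1) - durfeeSum q (a + 2)) := by
  have hs := fun a b => by simpa only [add_zero] using summable_durfee hq a b 0
  have hj : ∀ j, qPoch q q j ≠ 0 := qPoch_ne_zero hq hq
  have ha : ∀ j, 1 - q ^ (j + 1) ≠ 0 := fun j => one_sub_pow_ne_zero hq (Nat.succ_ne_zero j)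
  have e1 : durfeeSum q a - durfeeSum q (a + 1) =
      ∑' j : ℕ, (q ^ (j ^ 2 + a * j) * (1 - q ^ j) / (qPoch q q j * qPoch q q (j + (a + 1))) -
        q ^ (j ^ 2 + (a + 1) * j + (a + 1)) / (qPoch q q j * qPoch q q (j + (a + 1)))) := by
    rw [durfeeSum, durfeeSum, ← (hs a a).tsum_sub (hs (a + 1) (a + 1))]
    refine tsum_congr fun j => ?_
    rw [← add_assoc, qPoch_self_succ]
    have := hj j
    have := hj (j + a)
    have := ha (j + a)
    field_simp
    ring
  have s1 : Summable fun j : ℕ =>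
      q ^ (j ^ 2 + a * j) * (1 - q ^ j) / (qPoch q q j * qPoch q q (j + (a + 1))) := by
    refine ((hs a (a + 1)).sub (hs (a + 1) (a + 1))).congr fun j => ?_
    ring
  have e2 : ∑' j : ℕ, q ^ (j ^ 2 + a * j) * (1 - q ^ j) /
        (qPoch q q j * qPoch q q (j + (a + 1))) =
      ∑' j : ℕ, q ^ (j ^ 2 + (a + 2) * j + (a + 1)) / (qPoch q q j * qPoch q q (j + (a + 2))) := by
    rw [s1.tsum_eq_zero_add]
    simp only [pow_zero, sub_self, mul_zero, zero_div, zero_add]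
    refine tsum_congr fun j => ?_
    rw [qPoch_self_succ, show j + 1 + (a + 1) = j + (a + 2) by ring]
    have := hj j
    have := hj (j + (a + 2))
    have := ha j
    field_simp
    ring
  rw [e1, s1.tsum_sub (summable_durfee hq _ _ _), e2,
    ← (summable_durfee hq _ _ _).tsum_sub (summable_durfee hq _ _ _), durfeeSum, durfeeSum,
    ← (hs _ _).tsum_sub (hs _ _), ← tsum_mul_left]
  refine tsum_congr fun j => ?_
  rw [show j + (a + 2) = j + (a + 1) + 1 by ring, qPoch_self_succ]
  have := hj j
  have := hj (j + (a + 1))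
  have := ha (j + (a + 1))
  field_simp
  ring

theorem tendsto_durfeeSum : Tendsto (durfeeSum q) atTop (𝓝 (qPochInf q q)⁻¹) := by
  obtain ⟨C, h0, hC⟩ := exists_norm_inv_qPoch_self_le hq
  have hT : Tendsto (durfeeSum q) atTop
      (𝓝 (∑' j : ℕ, if j = 0 then (qPochInf q q)⁻¹ else 0)) := by
    refine tendsto_tsum_of_dominated_convergence
      (bound := fun j => C * C * ‖q‖ ^ j) ((summable_norm_pow hq).mul_left _)
      (fun j => ?_) (Eventually.of_forall fun a j => ?_)
    · split_ifs with hj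
      · subst hj
        simpa [qPoch_zero] using tendsto_inv_qPoch_self hq
      · refine squeeze_zero_norm (a := fun a => C * C * ‖q‖ ^ a) (fun a => ?_) ?_
        · exact norm_div_qPoch_mul_qPoch_le hq h0 hC
            (Nat.le_add_left_of_le (Nat.le_mul_of_pos_right a (Nat.pos_of_ne_zero hj))) _ _
        · simpa using (tendsto_pow_atTop_nhds_zero_of_lt_one (norm_nonneg q) hq).const_mul (C * C)
    · exact norm_div_qPoch_mul_qPoch_le hq h0 hC
        (by nlinarith [Nat.le_self_pow two_ne_zero j]) _ _
  rwa [tsum_ite_eq] at hT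

/-- Iterating `durfeeSum_sub_succ` bounds consecutive differences by `‖q‖^k B` for every `k`, so the
sum does not depend on `a`; as `a → ∞` only its `j = 0` term survives. -/
theorem durfeeSum_eq (a : ℕ) : durfeeSum q a = (qPochInf q q)⁻¹ := by
  obtain ⟨B, hB⟩ := (((tendsto_durfeeSum hq).sub
    ((tendsto_durfeeSum hq).comp (tendsto_add_atTop_nat 1))).norm).bddAbove_range
  have hB' : ∀ a, ‖durfeeSum q a - durfeeSum q (a + 1)‖ ≤ B := fun a => hB ⟨a, rfl⟩
  have hb : ∀ k a, ‖durfeeSum q a - durfeeSum q (a + 1)‖ ≤ ‖q‖ ^ k * B := by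
    intro k
    induction k with
    | zero => simpa using hB'
    | succ k ih =>
      intro a
      rw [durfeeSum_sub_succ hq, norm_mul, norm_neg, pow_succ' ‖q‖, mul_assoc]
      exact mul_le_mul ((norm_pow_le_norm_pow hq (by omega : 1 ≤ a + 1)).trans_eq (pow_one _))
        (ih _) (norm_nonneg _) (norm_nonneg _)
  have hz : ∀ a, durfeeSum q a = durfeeSum q (a + 1) := fun a => by
    have ht : Tendsto (fun k => ‖q‖ ^ k * B) atTop (𝓝 0) := by
      simpa using (tendsto_pow_atTop_nhds_zero_of_lt_one (norm_nonneg q) hq).mul_const B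
    have := ge_of_tendsto' ht fun k => hb k a
    exact sub_eq_zero.mp (norm_le_zero_iff.mp this)
  have hc : ∀ k, durfeeSum q (k + a) = durfeeSum q a := fun k => by
    induction k with
    | zero => rw [zero_add]
    | succ k ih => rw [← ih, hz (k + a), Nat.add_right_comm]
  exact tendsto_nhds_unique (tendsto_const_nhds.congr fun k => (hc k).symm)
    ((tendsto_durfeeSum hq).comp (tendsto_add_atTop_nat a))

/-- The limiting case of Bailey's lemma relative to `a = 1`. -/
theorem hasSum_bailey {A : ℕ → ℂ} {B : ℝ} (hA : ∀ s, ‖A s‖ ≤ B) :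
    HasSum (fun n : ℕ => q ^ (n ^ 2) *
        ∑ s ∈ range (n + 1), A s / (qPoch q q (n - s) * qPoch q q (n + s)))
      ((∑' s : ℕ, A s * q ^ (s ^ 2)) / qPochInf q q) := by
  obtain ⟨C, h0, hC⟩ := exists_norm_inv_qPoch_self_le hq
  have hB : 0 ≤ B := (norm_nonneg _).trans (hA 0)
  -- Here `n = s + j`: summing over `j` gives a Durfee sum with difference `2s`, and summing over
  -- antidiagonals restores the sum over `n`.
  let F : ℕ × ℕ → ℂ := fun x =>
    A x.1 * (q ^ ((x.1 + x.2) ^ 2) / (qPoch q q x.2 * qPoch q q (x.2 + 2 * x.1)))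
  have hF : Summable F := by
    have hm : Summable fun x : ℕ × ℕ => ‖q‖ ^ x.1 * ‖q‖ ^ x.2 :=
      (summable_norm_pow hq).mul_of_nonneg (summable_norm_pow hq)
        (fun n => pow_nonneg (norm_nonneg q) n) fun n => pow_nonneg (norm_nonneg q) n
    refine Summable.of_norm_bounded (hm.mul_left (B * (C * C))) fun x => ?_
    rw [norm_mul, mul_assoc, ← pow_add]
    exact mul_le_mul (hA _) (norm_div_qPoch_mul_qPoch_le hq h0 hC
      (Nat.le_self_pow two_ne_zero _) _ _) (norm_nonneg _) hB
  have hrow : ∀ s, ∑' j, F (s, j) = A s * q ^ (s ^ 2) * (qPochInf q q)⁻¹ := fun s => by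
    rw [← durfeeSum_eq hq (2 * s), durfeeSum, ← tsum_mul_left]
    refine tsum_congr fun j => ?_
    simp only [F]
    rw [show (s + j) ^ 2 = s ^ 2 + (j ^ 2 + 2 * s * j) by ring, pow_add]
    ring
  have hval : ∑' x, F x = (∑' s : ℕ, A s * q ^ (s ^ 2)) / qPochInf q q := by
    rw [hF.tsum_prod, tsum_congr hrow, tsum_mul_right, div_eq_mul_inv]
  have hS := Finset.HasAntidiagonal.sigmaAntidiagonalEquivProd.hasSum_iff.mpr
    (hval ▸ hF.hasSum)
  convert hS.sigma fun n => hasSum_fintype _ using 2 with n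
  change _ = ∑ b : antidiagonal n, F b
  rw [Finset.sum_coe_sort (antidiagonal n) F, Finset.Nat.sum_antidiagonal_eq_sum_range_succ_mk,
    mul_sum]
  refine sum_congr rfl fun s hs => ?_
  have hs : s ≤ n := Nat.lt_succ_iff.mp (mem_range.mp hs)
  simp only [F]
  rw [Nat.add_sub_cancel' hs, show n - s + 2 * s = n + s by omega]
  ring

end

/-! ### Summation in blocks of three and the main theorem -/

theorem hasSum_three_mul {f : ℕ → ℂ} {a : ℂ} (hf : HasSum f a) :
    HasSum (fun m => f (3 * m) + f (3 * m + 1) + f (3 * m + 2)) a := by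
  have h := ((Nat.divModEquiv 3).symm.hasSum_iff.mpr hf).prod_fiberwise fun m => hasSum_fintype _
  convert h using 2 with m
  simp [Fin.sum_univ_three, Nat.mul_comm]

/-- Bailey's lemma leaves `(-q³;q⁶)_∞ / ((q;q²)_∞ (-q;q²)_∞)`, whose denominator is `(q²;q⁴)_∞`;
Euler's identity inverts it. -/
theorem hasSum_pow_sq_mul_beta_three {q : ℂ} (hq : ‖q‖ < 1) :
    HasSum (fun n : ℕ => q ^ (n ^ 2) * beta 3 q n)
      (qPochInf (-q ^ 2) (q ^ 2) * qPochInf (-q ^ 3) (q ^ 6)) := by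
  have h2 := norm_pow_lt_one hq two_ne_zero
  have h4 := norm_pow_lt_one h2 two_ne_zero
  have hJ := tsum_alpha_three_mul_pow_sq hq
  have hE := qPochInf_neg_self_mul h2
  have hN := qPochInf_mul_neg q h2
  have hP := qPochInf_eq_prod q hq two_ne_zero
  simp only [prod_range_succ, prod_range_zero, pow_zero, pow_one, mul_one, one_mul, ← sq] at hP
  have n1 := qPochInf_ne_zero_of_norm_lt hq h2
  have n2 := qPochInf_ne_zero_of_norm_lt h2 h2
  have n3 : qPochInf (-q) (q ^ 2) ≠ 0 :=
    qPochInf_ne_zero_of_norm_lt (by rwa [norm_neg]) h2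
  convert hasSum_bailey hq (norm_alpha_three_le q) using 1
  · funext n
    have h1 : ∀ s : ℕ, ((n : ℤ) - s).toNat = n - s := fun s => by omega
    have h2 : ∀ s : ℕ, ((n : ℤ) + s).toNat = n + s := fun s => by omega
    simp only [beta, h1, h2, show ((n : ℤ) + 1).toNat = n + 1 by omega]
  · rw [eq_div_iff (by rw [hP]; exact mul_ne_zero n1 n2), hP]
    refine mul_right_cancel₀ n3 ?_
    rw [hJ]
    linear_combination qPochInf (-q ^ 2) (q ^ 2) * qPochInf (-q ^ 3) (q ^ 6) *
      qPochInf (q ^ 2) (q ^ 2) * hN + qPochInf (-q ^ 3) (q ^ 6) * qPochInf (q ^ 2) (q ^ 2) * hE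

theorem hasSum_beta_three_blocks {q : ℂ} (hq : ‖q‖ < 1) :
    HasSum (fun m : ℕ => q ^ (9 * m ^ 2) *
        (q ^ (-6 * (m : ℤ) + 1) * beta 3 q (3 * (m : ℤ) - 1) + beta 3 q (3 * (m : ℤ))
          + q ^ (6 * m + 1) * beta 3 q (3 * (m : ℤ) + 1)))
      (qPochInf (-q ^ 2) (q ^ 2) * qPochInf (-q ^ 3) (q ^ 6)) := by
  have h := hasSum_pow_sq_mul_beta_three hq
  -- The shift by one makes block `m` consist of `3m-1, 3m, 3m+1`; it costs nothing because `β_{-1}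
  -- = 0`.
  let f : ℕ → ℂ := fun k => q ^ (((k : ℤ) - 1).natAbs ^ 2) * beta 3 q ((k : ℤ) - 1)
  have hf : HasSum f (qPochInf (-q ^ 2) (q ^ 2) * qPochInf (-q ^ 3) (q ^ 6)) := by
    have h0 : f 0 = 0 := by simp [f, beta]
    have := (hasSum_nat_add_iff (f := f) 1).mp (by simpa [f] using h)
    simpa [h0] using this
  convert hasSum_three_mul hf using 2 with m
  simp only [f]
  push_cast
  rw [show (3 * (m : ℤ) + 1 - 1) = 3 * m by ring, show (3 * (m : ℤ) + 2 - 1) = 3 * m + 1 by ring,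
    show (3 * (m : ℤ)).natAbs = 3 * m by omega, show (3 * (m : ℤ) + 1).natAbs = 3 * m + 1 by omega,
    mul_add, mul_add]
  congr 1
  · congr 1
    · rw [← mul_assoc]
      rcases m with _ | m
      · simp [beta]
      · congr 1
        rw [show (3 * ((m + 1 : ℕ) : ℤ) - 1).natAbs = 3 * m + 2 by omega]
        -- Adding integer exponents requires `q ≠ 0`; at `q = 0` both sides vanish, as the natural
        -- exponents are positive.
        rcases eq_or_ne q 0 with rfl | h0
        · simp
        · rw [← zpow_natCast, ← zpow_natCast, ← zpow_add₀ h0]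
          congr 1
          push_cast
          ring
    · ring_nf
  · ring

end Capparelli

theorem mainTheorem3 (q : ℂ) (hq : ‖q‖ < 1) :
    HasSum
      (fun m : ℕ => q ^ (9 * m ^ 2) *
        (q ^ (-6 * (m : ℤ) + 1) * Capparelli.beta 3 q (3 * (m : ℤ) - 1)
          + Capparelli.beta 3 q (3 * (m : ℤ))
          + q ^ (6 * m + 1) * Capparelli.beta 3 q (3 * (m : ℤ) + 1)))
      (1 / (Capparelli.qPochInf (q ^ 2) (q ^ 12) * Capparelli.qPochInf (q ^ 3) (q ^ 12) *
        Capparelli.qPochInf (q ^ 9) (q ^ 12) * Capparelli.qPochInf (q ^ 10) (q ^ 12))) ∧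
    HasSum
      (fun m : ℕ => ∑ r ∈ Finset.range (2 * m + 1),
        q ^ (9 * m ^ 2) * Capparelli.sigma q m r *
          (q ^ (1 - 6 * (m : ℤ)) *
              (q ^ (6 * m) - (1 - q ^ (6 * m + 1)) / (1 - q ^ (3 * r + 1)))
            + 1
            + q ^ (6 * m + 1) / (1 - q ^ (6 * m + 2)) * (1 / (1 - q ^ (3 * r + 1)) - 1)))
      (1 / (Capparelli.qPochInf (q ^ 2) (q ^ 12) * Capparelli.qPochInf (q ^ 3) (q ^ 12) *
        Capparelli.qPochInf (q ^ 9) (q ^ 12) * Capparelli.qPochInf (q ^ 10) (q ^ 12))) ∧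
    Capparelli.qPochInf q (q ^ 6) * Capparelli.qPochInf (q ^ 5) (q ^ 6) *
        Capparelli.qPochInf (q ^ 6) (q ^ 6) *
        (Capparelli.qPochInf (q ^ 4) (q ^ 12) * Capparelli.qPochInf (q ^ 8) (q ^ 12)) /
        Capparelli.qPochInf q q =
      1 / (Capparelli.qPochInf (q ^ 2) (q ^ 12) * Capparelli.qPochInf (q ^ 3) (q ^ 12) *
        Capparelli.qPochInf (q ^ 9) (q ^ 12) * Capparelli.qPochInf (q ^ 10) (q ^ 12)) ∧
    1 / (Capparelli.qPochInf (q ^ 2) (q ^ 12) * Capparelli.qPochInf (q ^ 3) (q ^ 12) *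
        Capparelli.qPochInf (q ^ 9) (q ^ 12) * Capparelli.qPochInf (q ^ 10) (q ^ 12)) =
      Capparelli.qPochInf (-q ^ 2) (q ^ 2) * Capparelli.qPochInf (-q ^ 3) (q ^ 6) := by
  have hprod := Capparelli.product_mul_eq_one hq
  have hval := eq_comm.mp (eq_one_div_of_mul_eq_one_right hprod)
  have h1 := Capparelli.hasSum_beta_three_blocks hq
  rw [← hval] at h1
  refine ⟨h1, ?_, Capparelli.product_quotient_eq hq, hval⟩
  obtain ⟨w, hw⟩ := Capparelli.exists_sq_add_self_add_one_eq_zero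
  convert h1 using 2 with m
  rw [Capparelli.beta_three_mul hq hw, Capparelli.beta_three_mul_add_one hq hw,
    Capparelli.beta_three_mul_sub_one hq hw, Finset.mul_sum, Finset.mul_sum,
    ← Finset.sum_add_distrib, ← Finset.sum_add_distrib, Finset.mul_sum]
  refine Finset.sum_congr rfl fun r _ => ?_
  rw [show (1 : ℤ) - 6 * m = -6 * m + 1 by ring]
  ring
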